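/- Let $V$ be a finite set and let $G$ be an undirected weighted graph on $V$, i.e. a symmetric nonnegative weight matrix $W_G=(w_{ij})_{i,j\in V}$. Let $D=\operatorname{diag}(\sum_j w_{ij})$, and let $L$ be either the graph Laplacian $L=D-W_G$ or the normalized Laplacian $L=D^{-1/2}(D-W_G)D^{-1/2}$ (with the convention $0^{-1/2}=0$ for isolated vertices). For $\nu,\kappa>0$ let $$\widetilde L=\Big(\tfrac{2\nu}{\kappa^2}I+L\Big)^{\nu/2}$$ be the fractional graph Laplacian, the power being taken spectrally. Let $c\in\mathbb R$, $c\neq 0$, let $\Sigma\in\mathbb R^{V\times V}$ and $u_0\in\mathbb R^V$, and let $W_t$ ($t\ge 0$) be a standard $|V|$-dimensional Brownian motion. Consider the stochastic heat equation on the graph with matrix-scaled noise, $$\mathrm d u=-c\,\widetilde L\,u\,\mathrm dt+\Sigma\,\mathrm dW_t,\qquad u(0)=u_0,$$ that is, almost surely $u$ is continuous and $u(t)=u_0-c\int_0^t\widetilde L\,u(r)\,\mathrm dr+\Sigma W_t$ for all $t\ge0$. Then $\widetilde L$ is positive definite, and there are a unitary matrix $P\in\mathbb C^{V\times V}$ and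 real numbers $(\lambda_i)_{i\in V}$ with $P\widetilde LP^*=\operatorname{diag}(\lambda_i)$. The equation has a solution $u$, unique up to indistinguishability, and $u$ is a Gaussian process. For every unitary $P$ and all real $\lambda_i$ with $P\widetilde LP^*=\operatorname{diag}(\lambda_i)$, and for all $t\ge s\ge 0$, $$\operatorname{Cov}[u(t),u(s)]=P^*\,C(t,s)\,P,\qquad C(t,s)_{ij}=\frac1c\,\frac{(P\Sigma\Sigma^{\top}P^*)_{ij}}{\lambda_i+\lambda_j}\Big(e^{-c\lambda_i|t-s|}-e^{-c(\lambda_i t+\lambda_j s)}\Big),$$ where $\operatorname{Cov}[u(t),u(s)]_{ij}=\operatorname{Cov}(u_i(t),u_j(s))$. -/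

import Mathlib

open MeasureTheory ProbabilityTheory
open scoped NNReal Matrix

noncomputable section

/-- An undirected weighted graph on the vertex set `V`: a symmetric nonnegative weight function.
Two vertices are joined by an edge when their weight is nonzero; an unweighted graph is the case of
weights in `{0, 1}`. -/
structure WeightedGraph (V : Type*) where
  weight : V → V → ℝ
  symm : ∀ i j, weight i j = weight j i
  nonneg : ∀ i j, 0 ≤ weight i j

namespace WeightedGraph

variable {V : Type*} [Fintype V] [DecidableEq V]

/-- The accumulated weight `w_i = ∑ j, w_ij` of a vertex. -/
def degree (G : WeightedGraph V) (i : V) : ℝ := ∑ j, G.weight i j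

/-- The graph Laplacian `L = D_W - W`. -/
def laplacian (G : WeightedGraph V) : Matrix V V ℝ :=
  Matrix.diagonal G.degree - Matrix.of G.weight

/-- The symmetrically normalized graph Laplacian `D_W^{-1/2} L D_W^{-1/2}`, where the diagonal
entry of `D_W^{-1/2}` at a vertex of degree `0` is `0`. -/
def normalizedLaplacian (G : WeightedGraph V) : Matrix V V ℝ :=
  Matrix.diagonal (fun i => (Real.sqrt (G.degree i))⁻¹) * G.laplacian *
    Matrix.diagonal (fun i => (Real.sqrt (G.degree i))⁻¹)

end WeightedGraph

/-- The fractional Laplacian `((2ν/κ²) I + L)^{ν/2}` of a symmetric matrix `L`; the real power is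
the spectral one, given by the continuous functional calculus. -/
def fractionalLaplacian {V : Type*} [Fintype V] [DecidableEq V]
    (L : Matrix V V ℝ) (ν κ : ℝ) : Matrix V V ℝ :=
  cfc (fun x : ℝ => x ^ (ν / 2)) ((2 * ν / κ ^ 2) • (1 : Matrix V V ℝ) + L)

/-- `W` is a standard `|V|`-dimensional Brownian motion: its coordinates are independent standard
real Brownian motions started at `0`. -/
structure IsBrownianVector {V Ω : Type*} [MeasurableSpace Ω]
    (W : ℝ≥0 → Ω → V → ℝ) (μ : Measure Ω) : Prop where
  brownian : ∀ i, IsBrownianReal (fun t ω => W t ω i) μ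
  indep : iIndepFun (fun (i : V) (ω : Ω) (t : ℝ≥0) => W t ω i) μ

/-- `u` is a solution of `du = A u dt + S dW` with deterministic initial value `u₀`: almost surely
its paths are continuous and `u(t) = u₀ + ∫₀ᵗ A u(r) dr + S W(t)` for all `t ≥ 0`. (The matrix `S`
is constant, so the stochastic integral `∫₀ᵗ S dW` is `S W(t)`.) -/
def IsLinearSDESolution {V Ω : Type*} [Fintype V] [MeasurableSpace Ω]
    (A S : Matrix V V ℝ) (u₀ : V → ℝ) (W u : ℝ≥0 → Ω → V → ℝ) (μ : Measure Ω) : Prop :=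
  ∀ᵐ ω ∂μ, Continuous (fun t => u t ω) ∧
    ∀ t : ℝ≥0, u t ω = u₀ + (∫ r in (0 : ℝ)..t, A *ᵥ u r.toNNReal ω) + S *ᵥ W t ω

/-- The cross-covariance matrix `Cov[X, Y]_{ij} = Cov[X_i, Y_j]` of two real random vectors. -/
def crossCovariance {V Ω : Type*} [MeasurableSpace Ω]
    (X Y : Ω → V → ℝ) (μ : Measure Ω) : Matrix V V ℝ :=
  Matrix.of fun i j => cov[fun ω => X ω i, fun ω => Y ω j; μ]

/-- The matrix `C(t, s)` with entries
`(P Σ Σᵀ P*)_{ij} / (c (λ_i + λ_j)) * (exp (-c λ_i |t - s|) - exp (-c (λ_i t + λ_j s)))`. -/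
def shekCore {V : Type*} [Fintype V]
    (c : ℝ) (S : Matrix V V ℝ) (P : Matrix V V ℂ) (l : V → ℝ) (t s : ℝ) : Matrix V V ℂ :=
  Matrix.of fun i j =>
    (1 / (c : ℂ)) * ((P * (S * Sᵀ).map Complex.ofReal * Pᴴ) i j / ((l i + l j : ℝ) : ℂ)) *
      ((Real.exp (-c * l i * |t - s|) - Real.exp (-c * (l i * t + l j * s)) : ℝ) : ℂ)

end

/-! The noise is additive, so the equation is solved path by path. With `A = -c L̃` and `g = Σ W`,
the difference `u - g` is differentiable, and an integrating factor gives existence and uniqueness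
through variation of constants (`mildSolution_eq`, `eq_mildSolution`). No stochastic integral is
needed.

Partial integration turns this formula into `e^{tA} u₀` plus the Wiener integral of the smooth
kernel `e^{(t-r)A} Σ`. Its Riemann sums in Brownian increments converge almost surely
(`tendsto_riemannStieltjes`). They are jointly Gaussian and centred, and their covariances are
Riemann sums of the Itô isometry integral, so `isGaussianProcess_of_tendsto_ae` yields Gaussianity
and covariance in the limit.

The covariance is thus `∫₀ˢ e^{(t-r)A} Σ Σᵀ (e^{(s-r)A})ᵀ dr` for `s ≤ t`. Conjugation by `P` makes
both exponentials diagonal, and each entry becomes an elementary scalar integral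
(`unitary_conj_covariance`). Positive definiteness of `L̃` makes `λ_i + λ_j` nonzero. -/

/-! ### Positivity of the graph Laplacians. -/

namespace WeightedGraph

variable {V : Type*} [Fintype V] [DecidableEq V]

/-- Symmetrizing in the two vertices turns twice the quadratic form into `∑ w_ij (x_i - x_j)²`. -/
theorem posSemidef_laplacian (G : WeightedGraph V) : G.laplacian.PosSemidef := by
  refine Matrix.PosSemidef.of_dotProduct_mulVec_nonneg ?_ fun x => ?_
  · ext i j
    by_cases h : i = j
    · subst h; simp [laplacian]
    · simp [laplacian, Matrix.diagonal_apply_ne _ h, Matrix.diagonal_apply_ne' _ h, G.symm i j]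
  · have h1 : star x ⬝ᵥ (G.laplacian *ᵥ x) = ∑ i, ∑ j, G.weight i j * (x i ^ 2 - x i * x j) := by
      rw [laplacian, Matrix.sub_mulVec, star_trivial]
      refine Finset.sum_congr rfl fun i _ => ?_
      rw [Pi.sub_apply, Matrix.mulVec_diagonal, degree, Finset.sum_mul]
      change x i * (_ - ∑ j, G.weight i j * x j) = _
      rw [← Finset.sum_sub_distrib, Finset.mul_sum]
      exact Finset.sum_congr rfl fun j _ => by ring
    have h2 : star x ⬝ᵥ (G.laplacian *ᵥ x) = ∑ i, ∑ j, G.weight i j * (x j ^ 2 - x i * x j) := by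
      rw [h1, Finset.sum_comm]
      refine Finset.sum_congr rfl fun i _ => Finset.sum_congr rfl fun j _ => ?_
      rw [G.symm]; ring
    have h3 : 0 ≤ star x ⬝ᵥ (G.laplacian *ᵥ x) + star x ⬝ᵥ (G.laplacian *ᵥ x) := by
      nth_rw 1 [h1]
      rw [h2, ← Finset.sum_add_distrib]
      refine Finset.sum_nonneg fun i _ => ?_
      rw [← Finset.sum_add_distrib]
      refine Finset.sum_nonneg fun j _ => ?_
      have := mul_nonneg (G.nonneg i j) (sq_nonneg (x i - x j))
      nlinarith
    linarith

/-- Congruence preserves semidefiniteness even for a singular matrix, so isolated vertices do no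
harm. -/
theorem posSemidef_normalizedLaplacian (G : WeightedGraph V) :
    G.normalizedLaplacian.PosSemidef := by
  have h := G.posSemidef_laplacian.mul_mul_conjTranspose_same
    (Matrix.diagonal fun i => (Real.sqrt (G.degree i))⁻¹)
  rwa [Matrix.diagonal_conjTranspose, star_trivial] at h

end WeightedGraph

/-! ### Positive definiteness and unitary diagonalization. -/

section Spectral

open scoped ComplexOrder

variable {V : Type*} [Fintype V] [DecidableEq V]

theorem posDef_cfc_of_pos {M : Matrix V V ℝ} (hM : M.PosDef) {f : ℝ → ℝ}
    (hf : ∀ x, 0 < x → 0 < f x) : (cfc f M).PosDef := by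
  rw [hM.isHermitian.cfc_eq, Matrix.IsHermitian.cfc, Unitary.conjStarAlgAut_apply,
    Matrix.IsUnit.posDef_star_right_conjugate_iff Unitary.isUnit_coe, Matrix.posDef_diagonal_iff]
  exact fun i => hf _ (hM.eigenvalues_pos i)

theorem posDef_fractionalLaplacian {L : Matrix V V ℝ} (hL : L.PosSemidef) {ν κ : ℝ}
    (hν : 0 < ν) (hκ : 0 < κ) : (fractionalLaplacian L ν κ).PosDef :=
  posDef_cfc_of_pos ((Matrix.PosDef.one.smul (by positivity)).add_posSemidef hL)
    fun _ hx => Real.rpow_pos_of_pos hx _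

/-- The complexified real eigenvector matrix is still invertible, and congruence by it gives the
diagonal of positive eigenvalues. -/
theorem Matrix.PosDef.map_ofReal {M : Matrix V V ℝ} (hM : M.PosDef) :
    (M.map Complex.ofReal).PosDef := by
  rw [← Matrix.IsUnit.posDef_star_left_conjugate_iff
    (U := (hM.isHermitian.eigenvectorUnitary : Matrix V V ℝ).map Complex.ofReal)]
  · have h := hM.isHermitian.conjStarAlgAut_star_eigenvectorUnitary
    rw [Unitary.conjStarAlgAut_star_apply] at h
    have h2 := congrArg (fun N : Matrix V V ℝ => N.map Complex.ofRealHom) h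
    simp only [Matrix.map_mul] at h2
    have h3 : (star (hM.isHermitian.eigenvectorUnitary : Matrix V V ℝ)).map Complex.ofRealHom =
        star ((hM.isHermitian.eigenvectorUnitary : Matrix V V ℝ).map Complex.ofReal) := by
      ext i j; simp [Matrix.star_apply]
    rw [h3] at h2
    refine (Eq.symm h2) ▸ ?_
    rw [Matrix.diagonal_map (by simp), Matrix.posDef_diagonal_iff]
    intro i
    simpa using hM.eigenvalues_pos i
  · exact Unitary.isUnit_coe.map Complex.ofRealHom.mapMatrix

theorem Matrix.IsHermitian.map_ofReal {V : Type*} {M : Matrix V V ℝ} (hM : M.IsHermitian) :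
    (M.map Complex.ofReal).IsHermitian := by
  ext i j
  simpa using congrFun (congrFun hM i) j

theorem exists_unitary_diagonalization {M : Matrix V V ℂ} (hM : M.IsHermitian) :
    ∃ P ∈ Matrix.unitaryGroup V ℂ, ∃ l : V → ℝ,
      P * M * Pᴴ = Matrix.diagonal (fun i => (l i : ℂ)) := by
  refine ⟨star (hM.eigenvectorUnitary : Matrix V V ℂ), Unitary.star_mem (Subtype.prop _),
    hM.eigenvalues, ?_⟩
  have h := hM.conjStarAlgAut_star_eigenvectorUnitary
  rw [Unitary.conjStarAlgAut_star_apply] at h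
  rw [← Matrix.star_eq_conjTranspose, star_star, h]
  rfl

theorem pos_of_unitary_diagonalization {M P : Matrix V V ℂ} (hM : M.PosDef)
    (hP : P ∈ Matrix.unitaryGroup V ℂ) {l : V → ℝ}
    (h : P * M * Pᴴ = Matrix.diagonal (fun i => (l i : ℂ))) (i : V) : 0 < l i := by
  have hP' : IsUnit P := Unitary.isUnit_coe (U := ⟨P, hP⟩)
  have h2 := (Matrix.IsUnit.posDef_star_right_conjugate_iff (x := M) hP').2 hM
  rw [Matrix.star_eq_conjTranspose, h, Matrix.posDef_diagonal_iff] at h2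
  simpa using h2 i

end Spectral

/-! ### Matrix exponentials. -/

section Exponential

variable {V : Type*} [Fintype V] [DecidableEq V]

theorem hasDerivAt_matrix_exp_smul (A : Matrix V V ℝ) (t : ℝ) :
    HasDerivAt (fun x : ℝ => NormedSpace.exp (x • A)) (A * NormedSpace.exp (t • A)) t := by
  open scoped Matrix.Norms.Operator in exact hasDerivAt_exp_smul_const' A t

theorem hasDerivAt_matrix_exp_smul_apply (A : Matrix V V ℝ) (t : ℝ) (i j : V) :
    HasDerivAt (fun x : ℝ => NormedSpace.exp (x • A) i j) ((A * NormedSpace.exp (t • A)) i j) t :=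
  hasDerivAt_pi.1 (hasDerivAt_pi.1 (hasDerivAt_matrix_exp_smul A t) i) j

theorem unitary_conj_map_exp {A : Matrix V V ℝ} {P : Matrix V V ℂ}
    (hP : P ∈ Matrix.unitaryGroup V ℂ) {a : V → ℂ}
    (h : P * A.map Complex.ofReal * Pᴴ = Matrix.diagonal a) (x : ℝ) :
    P * (NormedSpace.exp (x • A)).map Complex.ofReal * Pᴴ =
      Matrix.diagonal fun i => Complex.exp (x * a i) := by
  have hinv : P⁻¹ = Pᴴ := Matrix.inv_eq_right_inv (Matrix.mem_unitaryGroup_iff.1 hP)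
  have hU : IsUnit P := Unitary.isUnit_coe (U := ⟨P, hP⟩)
  have h1 : (NormedSpace.exp (x • A)).map Complex.ofReal =
      NormedSpace.exp ((x : ℂ) • A.map Complex.ofReal) := by
    have h2 : (x • A).map Complex.ofReal = (x : ℂ) • A.map Complex.ofReal := by
      ext i j; simp
    rw [← h2]
    open scoped Matrix.Norms.Operator in
    exact NormedSpace.map_exp Complex.ofRealHom.mapMatrix
      (continuous_id.matrix_map Complex.continuous_ofReal) (x • A)
  rw [h1, ← hinv, ← Matrix.exp_conj _ _ hU, Matrix.mul_smul, Matrix.smul_mul, hinv, h,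
    ← Matrix.diagonal_smul, Matrix.exp_diagonal]
  congr 1
  ext i
  rw [Pi.coe_exp, Complex.exp_eq_exp_ℂ]
  rfl

end Exponential

/-! ### Almost sure limits of Gaussian variables and processes. -/

section GaussianLimit

open Filter Topology

variable {Ω : Type*} [MeasurableSpace Ω] {μ : Measure Ω}

/-- Characteristic functions converge by dominated convergence, which identifies the limit law. The
variance of `Y` is then read off that law, so no uniform integrability argument is needed. -/
theorem map_eq_gaussianReal_of_tendsto_ae [IsProbabilityMeasure μ] {X : ℕ → Ω → ℝ} {Y : Ω → ℝ}
    {m v : ℝ} (hX : ∀ n, HasGaussianLaw (X n) μ)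
    (hm : Tendsto (fun n => μ[X n]) atTop (𝓝 m))
    (hv : Tendsto (fun n => Var[X n; μ]) atTop (𝓝 v))
    (hlim : ∀ᵐ ω ∂μ, Tendsto (fun n => X n ω) atTop (𝓝 (Y ω))) :
    μ.map Y = gaussianReal m v.toNNReal ∧ Var[Y; μ] = v := by
  have hY : AEMeasurable Y μ := aemeasurable_of_tendsto_metrizable_ae atTop
    (fun n => (hX n).aemeasurable) hlim
  have hv0 : 0 ≤ v := ge_of_tendsto' hv fun n => variance_nonneg _ _
  have := Measure.isProbabilityMeasure_map hY
  suffices h : μ.map Y = gaussianReal m v.toNNReal by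
    refine ⟨h, ?_⟩
    have h2 := variance_map (X := id) (by fun_prop) hY
    rw [h, variance_id_gaussianReal, Real.coe_toNNReal _ hv0] at h2
    exact h2.symm
  refine Measure.ext_of_charFun (funext fun t => ?_)
  rw [charFun_gaussianReal, Real.coe_toNNReal _ hv0]
  have h1 : Tendsto (fun n => charFun (μ.map (X n)) t) atTop (𝓝 (charFun (μ.map Y) t)) := by
    simp_rw [charFun_apply_real]
    rw [integral_map hY (by fun_prop)]
    simp_rw [fun n => integral_map (hX n).aemeasurable (μ := μ)
      (f := fun x : ℝ => Complex.exp (t * x * Complex.I)) (by fun_prop)]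
    refine tendsto_integral_of_dominated_convergence (fun _ => 1) (fun n => ?_)
      (integrable_const _) (fun n => ?_) ?_
    · exact ((by fun_prop : Measurable fun x : ℝ =>
        Complex.exp (t * x * Complex.I)).comp_aemeasurable (hX n).aemeasurable).aestronglyMeasurable
    · refine Eventually.of_forall fun ω => ?_
      rw [← Complex.ofReal_mul, Complex.norm_exp_ofReal_mul_I]
    · filter_upwards [hlim] with ω hω
      exact ((by fun_prop : Continuous fun x : ℝ =>
        Complex.exp (t * x * Complex.I)).tendsto _).comp hω
  refine tendsto_nhds_unique h1 ?_
  have h2 : ∀ n, charFun (μ.map (X n)) t =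
      Complex.exp (t * (μ[X n] : ℝ) * Complex.I - Var[X n; μ] * t ^ 2 / 2) := fun n => by
    rw [(hX n).map_eq_gaussianReal, charFun_gaussianReal, Real.coe_toNNReal _ (variance_nonneg _ _)]
  simp_rw [h2]
  have hm' := (Complex.continuous_ofReal.tendsto m).comp hm
  have hv' := (Complex.continuous_ofReal.tendsto v).comp hv
  exact (Complex.continuous_exp.tendsto _).comp
    (((hm'.const_mul (t : ℂ)).mul_const Complex.I).sub ((hv'.mul_const _).div_const 2))

theorem isGaussianProcess_of_tendsto_ae [IsProbabilityMeasure μ] {T : Type*}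
    {X : ℕ → T → Ω → ℝ} {Y : T → Ω → ℝ} {m : T → ℝ} {C : T → T → ℝ}
    (hX : ∀ n, IsGaussianProcess (X n) μ)
    (hm : ∀ t, Tendsto (fun n => μ[X n t]) atTop (𝓝 (m t)))
    (hC : ∀ s t, Tendsto (fun n => cov[X n s, X n t; μ]) atTop (𝓝 (C s t)))
    (hlim : ∀ t, ∀ᵐ ω ∂μ, Tendsto (fun n => X n t ω) atTop (𝓝 (Y t ω))) :
    IsGaussianProcess Y μ ∧ ∀ s t, cov[Y s, Y t; μ] = C s t := by
  have hX2 : ∀ n t, MemLp (X n t) 2 μ := fun n t => ((hX n).hasGaussianLaw_eval t).memLp_two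
  have hY : ∀ t, AEMeasurable (Y t) μ := fun t => aemeasurable_of_tendsto_metrizable_ae atTop
    (fun n => (hX n).aemeasurable t) (hlim t)
  -- Cramér–Wold: every finite linear combination is handled by the scalar case.
  have key : ∀ (k : ℕ) (f : Fin k → T) (c : Fin k → ℝ),
      μ.map (fun ω => ∑ i, c i * Y (f i) ω) = gaussianReal (∑ i, c i * m (f i))
        (∑ i, ∑ j, c i * (c j * C (f i) (f j))).toNNReal ∧
      Var[fun ω => ∑ i, c i * Y (f i) ω; μ] = ∑ i, ∑ j, c i * (c j * C (f i) (f j)) := by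
    intro k f c
    refine map_eq_gaussianReal_of_tendsto_ae (X := fun n ω => ∑ i, c i * X n (f i) ω) ?_ ?_ ?_ ?_
    · intro n
      have := (((hX n).comp_right f).hasGaussianLaw Finset.univ).map_fun
        (∑ i, c i • ContinuousLinearMap.proj (R := ℝ)
          (φ := fun _ : (Finset.univ : Finset (Fin k)) => ℝ) ⟨i, Finset.mem_univ i⟩)
      simpa using this
    · have : ∀ n, ∫ ω, ∑ i, c i * X n (f i) ω ∂μ = ∑ i, c i * μ[X n (f i)] := fun n => by
        rw [integral_finsetSum _ fun i _ => ((hX2 n (f i)).integrable (by norm_num)).const_mul _]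
        simp_rw [integral_const_mul]
      simp_rw [this]
      exact tendsto_finsetSum _ fun i _ => (hm (f i)).const_mul _
    · have : ∀ n, Var[fun ω => ∑ i, c i * X n (f i) ω; μ] =
          ∑ i, ∑ j, c i * (c j * cov[X n (f i), X n (f j); μ]) := fun n => by
        rw [← covariance_self ((Finset.aemeasurable_fun_sum _ fun i _ =>
          ((hX n).aemeasurable _).const_mul _)),
          covariance_fun_sum_fun_sum (fun i => (hX2 n (f i)).const_mul (c i))
            (fun i => (hX2 n (f i)).const_mul (c i))]
        simp_rw [covariance_const_mul_left, covariance_const_mul_right]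
      simp_rw [this]
      exact tendsto_finsetSum _ fun i _ => tendsto_finsetSum _ fun j _ =>
        ((hC (f i) (f j)).const_mul _).const_mul _
    · filter_upwards [ae_all_iff.2 fun i => hlim (f i)] with ω hω
      exact tendsto_finsetSum _ fun i _ => (hω i).const_mul _
  have hG : IsGaussianProcess Y μ := by
    refine ⟨fun I => ⟨⟨fun L => ?_⟩⟩⟩
    have hYI : AEMeasurable (fun ω => I.restrict (Y · ω)) μ :=
      aemeasurable_pi_lambda _ fun i => hY i
    classical
    have hL : ∀ x : I → ℝ, L x =
        ∑ i, L (Pi.single (I.equivFin.symm i) 1) * x (I.equivFin.symm i) := fun x => by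
      rw [Equiv.sum_comp I.equivFin.symm fun i => L (Pi.single i 1) * x i,
        ← ContinuousLinearMap.coe_coe, LinearMap.pi_apply_eq_sum_univ L.toLinearMap x]
      refine Finset.sum_congr rfl fun i _ => ?_
      rw [smul_eq_mul, mul_comm]
      congr 2
      ext j
      simp [Pi.single_apply, eq_comm]
    have h2 : IsGaussian ((μ.map fun ω => I.restrict (Y · ω)).map L) := by
      rw [AEMeasurable.map_map_of_aemeasurable (by fun_prop) hYI]
      have h1 := (key I.card (fun i => I.equivFin.symm i)
        fun i => L (Pi.single (I.equivFin.symm i) 1)).1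
      have h4 : (L ∘ fun ω => I.restrict (Y · ω)) = fun ω => ∑ i,
          L (Pi.single (I.equivFin.symm i) 1) * Y (I.equivFin.symm i) ω := funext fun ω => hL _
      rw [h4, h1]
      infer_instance
    have h3 : HasGaussianLaw L (μ.map fun ω => I.restrict (Y · ω)) := ⟨h2⟩
    exact h3.map_eq_gaussianReal
  refine ⟨hG, fun s t => ?_⟩
  have hY2 : ∀ t, MemLp (Y t) 2 μ := fun t => (hG.hasGaussianLaw_eval t).memLp_two
  have hvar : ∀ t, Var[Y t; μ] = C t t := fun t => by
    have h := (key 1 (fun _ => t) (fun _ => 1)).2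
    simpa only [Fin.sum_univ_one, one_mul] using h
  have hsymm : C t s = C s t := by
    refine tendsto_nhds_unique (hC t s) ((hC s t).congr fun n => ?_)
    exact covariance_comm _ _
  -- Polarization: the covariance is recovered from the variance of `Y s + Y t`.
  have h1 := (key 2 ![s, t] (fun _ => 1)).2
  have h2 := variance_add (hY2 s) (hY2 t)
  simp only [Fin.sum_univ_two, Matrix.cons_val_zero, Matrix.cons_val_one, one_mul] at h1
  rw [show (fun ω => Y s ω + Y t ω) = Y s + Y t from rfl, h2, hvar, hvar, hsymm] at h1
  linarith

end GaussianLimit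

/-! ### Riemann–Stieltjes sums against a continuous path. -/

section RiemannStieltjes

open Filter Topology Finset

/-- Summation by parts on one cell. `F r` needs no truncation on the left, because the increment
vanishes once `r ≥ t`. -/
theorem riemannStieltjes_term {F F' w : ℝ → ℝ} (hF : ∀ x, HasDerivAt F (F' x) x)
    (hF' : Continuous F') {r r' t : ℝ} (hr : r ≤ r') :
    F r * (w (min r' t) - w (min r t)) = (F (min r' t) * w (min r' t) - F (min r t) * w (min r t))
      - ∫ x in (min r t)..(min r' t), F' x * w (min r' t) := by
  rw [intervalIntegral.integral_mul_const,
    intervalIntegral.integral_eq_sub_of_hasDerivAt (fun x _ => hF x) (hF'.intervalIntegrable _ _)]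
  rcases le_total r t with h | h
  · rw [min_eq_left h]; ring
  · rw [min_eq_right h, min_eq_right (h.trans hr)]; ring

/-- The path `w` need not have bounded variation: summation by parts moves the derivative to `F`,
and uniform continuity of `w` on `[0, t]` controls the error. The `(n + 1)²` cells of width `1 / (n
+ 1)` cover `[0, n + 1]`, so one grid eventually serves every `t`. -/
theorem tendsto_riemannStieltjes {F F' w : ℝ → ℝ} (hF : ∀ x, HasDerivAt F (F' x) x)
    (hF' : Continuous F') (hw : Continuous w) {t : ℝ} (ht : 0 ≤ t) :
    Tendsto (fun n : ℕ => ∑ k ∈ range ((n + 1) ^ 2), F (k / (n + 1)) *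
      (w (min ((k + 1 : ℕ) / (n + 1)) t) - w (min (k / (n + 1)) t))) atTop
      (𝓝 (F t * w t - F 0 * w 0 - ∫ x in (0 : ℝ)..t, F' x * w x)) := by
  obtain ⟨M, hM⟩ := (isCompact_Icc (a := (0 : ℝ)) (b := t)).exists_bound_of_continuousOn
    hF'.continuousOn
  have hM0 : 0 ≤ M := (norm_nonneg _).trans (hM 0 ⟨le_rfl, ht⟩)
  have huc := (isCompact_Icc (a := (0 : ℝ)) (b := t)).uniformContinuousOn_of_continuous
    hw.continuousOn
  rw [Metric.uniformContinuousOn_iff] at huc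
  rw [Metric.tendsto_atTop]
  intro ε hε
  -- The total error is at most `M * t` times this tolerance; the `+ 1` keeps the denominator
  -- positive. Below, `n₁` makes the grid reach past `t` and `n₂` makes its mesh smaller than `δ`.
  obtain ⟨δ, hδ, hδw⟩ := huc (ε / (M * t + 1)) (by positivity)
  obtain ⟨n₁, hn₁⟩ := exists_nat_gt t
  obtain ⟨n₂, hn₂⟩ := exists_nat_one_div_lt hδ
  refine ⟨max n₁ n₂, fun n hn => ?_⟩
  set p : ℕ → ℝ := fun k => min (k / (n + 1)) t with hp
  have hn0 : (0 : ℝ) < n + 1 := by positivity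
  have hmono : ∀ k, p k ≤ p (k + 1) := fun k => by
    refine min_le_min_right _ ?_
    gcongr
    simp
  have hp0 : p 0 = 0 := by simp [hp, ht]
  have hpN : p ((n + 1) ^ 2) = t := by
    have h1 : (n₁ : ℝ) ≤ n := by exact_mod_cast (le_max_left _ _).trans hn
    simp only [hp]
    push_cast
    rw [pow_two, mul_div_assoc, div_self hn0.ne', mul_one, min_eq_right]
    linarith
  have hp0t : ∀ k, 0 ≤ p k ∧ p k ≤ t := fun k => ⟨le_min (by positivity) ht, min_le_right _ _⟩
  have hstep : ∀ k, p (k + 1) - p k < δ := fun k => by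
    have h1 : 1 / ((n : ℝ) + 1) ≤ 1 / (n₂ + 1) := by
      have : (n₂ : ℝ) ≤ n := by exact_mod_cast (le_max_right _ _).trans hn
      gcongr
    have h2 : p (k + 1) ≤ p k + 1 / (n + 1) := by
      simp only [hp]
      rw [min_add]
      refine min_le_min (le_of_eq ?_) (by linarith [show 0 ≤ 1 / ((n : ℝ) + 1) by positivity])
      push_cast; ring
    linarith
  have hsum : ∑ k ∈ range ((n + 1) ^ 2), F (k / (n + 1)) * (w (p (k + 1)) - w (p k)) =
      F t * w t - F 0 * w 0 -
        ∑ k ∈ range ((n + 1) ^ 2), ∫ x in (p k)..(p (k + 1)), F' x * w (p (k + 1)) := by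
    rw [← hpN, ← hp0, ← sum_range_sub (fun k => F (p k) * w (p k)), ← sum_sub_distrib]
    refine sum_congr rfl fun k _ => ?_
    have hk : (k : ℝ) / (n + 1) ≤ (k + 1 : ℕ) / (n + 1) := by gcongr; simp
    exact riemannStieltjes_term hF hF' hk
  have hFw : Continuous fun x => F' x * w x := hF'.mul hw
  have hint : ∫ x in (0 : ℝ)..t, F' x * w x =
      ∑ k ∈ range ((n + 1) ^ 2), ∫ x in (p k)..(p (k + 1)), F' x * w x := by
    rw [intervalIntegral.sum_integral_adjacent_intervals
      (fun k _ => hFw.intervalIntegrable _ _), hp0, hpN]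
  change dist (∑ k ∈ range ((n + 1) ^ 2), F (k / (n + 1)) * (w (p (k + 1)) - w (p k))) _ < ε
  rw [hsum, hint, Real.dist_eq, sub_sub_sub_cancel_left, ← sum_sub_distrib]
  have hterm : ∀ k, |(∫ x in (p k)..(p (k + 1)), F' x * w x) -
      ∫ x in (p k)..(p (k + 1)), F' x * w (p (k + 1))| ≤
      M * (ε / (M * t + 1)) * (p (k + 1) - p k) := fun k => by
    have hFc : Continuous fun x => F' x * w (p (k + 1)) := hF'.mul continuous_const
    rw [← intervalIntegral.integral_sub (hFw.intervalIntegrable _ _) (hFc.intervalIntegrable _ _),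
      ← Real.norm_eq_abs,
      ← abs_of_nonneg (sub_nonneg.2 (hmono k))]
    refine intervalIntegral.norm_integral_le_of_norm_le_const fun x hx => ?_
    rw [Set.uIoc_of_le (hmono k)] at hx
    have hx1 : x ∈ Set.Icc 0 t := ⟨(hp0t k).1.trans hx.1.le, hx.2.trans (hp0t (k + 1)).2⟩
    rw [← mul_sub, norm_mul]
    refine mul_le_mul (hM x hx1) ?_ (norm_nonneg _) hM0
    rw [← dist_eq_norm]
    refine (hδw x hx1 _ (hp0t (k + 1)) ?_).le
    rw [Real.dist_eq, abs_sub_comm, abs_of_nonneg (by linarith [hx.2])]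
    linarith [hstep k, hx.1]
  calc _ ≤ ∑ k ∈ range ((n + 1) ^ 2), M * (ε / (M * t + 1)) * (p (k + 1) - p k) :=
        (abs_sum_le_sum_abs _ _).trans (sum_le_sum fun k _ => hterm k)
    _ = M * t * (ε / (M * t + 1)) := by
        rw [← mul_sum, sum_range_sub p, hpN, hp0]; ring
    _ < ε := by
        have : 0 < M * t + 1 := by positivity
        rw [mul_div_assoc', div_lt_iff₀ this]
        nlinarith

theorem tendsto_riemann_sum {F F' : ℝ → ℝ} (hF : ∀ x, HasDerivAt F (F' x) x)
    (hF' : Continuous F') {t : ℝ} (ht : 0 ≤ t) :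
    Tendsto (fun n : ℕ => ∑ k ∈ range ((n + 1) ^ 2), F (k / (n + 1)) *
      (min ((k + 1 : ℕ) / (n + 1) : ℝ) t - min (k / (n + 1) : ℝ) t)) atTop
      (𝓝 (∫ x in (0 : ℝ)..t, F x)) := by
  have h := tendsto_riemannStieltjes hF hF' continuous_id ht
  have h2 := intervalIntegral.integral_mul_deriv_eq_deriv_mul (a := 0) (b := t) (u := F)
    (v := id) (fun x _ => hF x) (fun x _ => hasDerivAt_id x)
    (hF'.intervalIntegrable _ _) (continuous_const.intervalIntegrable _ _)
  simp only [mul_one] at h2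
  rw [h2]
  exact h

end RiemannStieltjes

/-! ### Variation of constants with a continuous forcing term. -/

section LinearODE

variable {V : Type*} [Fintype V] [DecidableEq V]

theorem HasDerivAt.matrix_mulVec {V : Type*} [Fintype V] {M : ℝ → Matrix V V ℝ} {M' : Matrix V V ℝ}
    {f : ℝ → V → ℝ} {f' : V → ℝ} {t : ℝ} (hM : HasDerivAt M M' t) (hf : HasDerivAt f f' t) :
    HasDerivAt (fun x => M x *ᵥ f x) (M' *ᵥ f t + M t *ᵥ f') t := by
  refine hasDerivAt_pi.2 fun i => ?_
  have h := HasDerivAt.fun_sum (u := Finset.univ) fun j _ =>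
    (hasDerivAt_pi.1 (hasDerivAt_pi.1 hM i) j).mul (hasDerivAt_pi.1 hf j)
  simpa [Finset.sum_add_distrib] using! h

theorem continuous_matrix_exp_smul (A : Matrix V V ℝ) :
    Continuous fun x : ℝ => NormedSpace.exp (x • A) :=
  continuous_matrix fun i j => continuous_iff_continuousAt.2 fun t =>
    (hasDerivAt_matrix_exp_smul_apply A t i j).continuousAt

theorem hasDerivAt_matrix_exp_sub_smul (A : Matrix V V ℝ) (t r : ℝ) :
    HasDerivAt (fun r : ℝ => NormedSpace.exp ((t - r) • A))
      (-(A * NormedSpace.exp ((t - r) • A))) r := by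
  refine hasDerivAt_pi.2 fun i => hasDerivAt_pi.2 fun j => ?_
  have h := (hasDerivAt_matrix_exp_smul_apply A (t - r) i j).comp r
    ((hasDerivAt_id r).const_sub t)
  simpa using! h

theorem matrix_exp_smul_mul_exp_smul (A : Matrix V V ℝ) (s t : ℝ) :
    NormedSpace.exp (s • A) * NormedSpace.exp (t • A) = NormedSpace.exp ((s + t) • A) := by
  rw [add_smul, Matrix.exp_add_of_commute _ _ (((Commute.refl A).smul_left s).smul_right t)]

theorem commute_matrix_exp_smul (A : Matrix V V ℝ) (t : ℝ) :
    A * NormedSpace.exp (t • A) = NormedSpace.exp (t • A) * A :=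
  open scoped Matrix.Norms.Operator in ((Commute.refl A).smul_right t).exp_right.eq

/-- The solution of `u(t) = u₀ + ∫₀ᵗ A u(r) dr + g(t)` given by variation of constants. -/
noncomputable def mildSolution (A : Matrix V V ℝ) (u₀ : V → ℝ) (g : ℝ → V → ℝ) (t : ℝ) : V → ℝ :=
  NormedSpace.exp (t • A) *ᵥ (u₀ + ∫ r in (0 : ℝ)..t, NormedSpace.exp ((-r) • A) *ᵥ (A *ᵥ g r))
    + g t

variable {A : Matrix V V ℝ} {u₀ : V → ℝ} {g : ℝ → V → ℝ}

theorem continuous_exp_neg_mulVec (hg : Continuous g) :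
    Continuous fun r : ℝ => NormedSpace.exp ((-r) • A) *ᵥ (A *ᵥ g r) :=
  ((continuous_matrix_exp_smul A).comp continuous_neg).matrix_mulVec
    (continuous_const.matrix_mulVec hg)

/-- Subtracting `g` is essential: `g` will be a Brownian path, so only the difference is
differentiable. -/
theorem hasDerivAt_mildSolution_sub (hg : Continuous g) (t : ℝ) :
    HasDerivAt (fun x => mildSolution A u₀ g x - g x) (A *ᵥ mildSolution A u₀ g t) t := by
  have hint : HasDerivAt
      (fun x => u₀ + ∫ r in (0 : ℝ)..x, NormedSpace.exp ((-r) • A) *ᵥ (A *ᵥ g r))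
      (NormedSpace.exp ((-t) • A) *ᵥ (A *ᵥ g t)) t :=
    ((continuous_exp_neg_mulVec hg).integral_hasStrictDerivAt 0 t).hasDerivAt.const_add _
  have h := (hasDerivAt_matrix_exp_smul A t).matrix_mulVec hint
  simp only [mildSolution, add_sub_cancel_right]
  convert h using 1
  rw [Matrix.mulVec_add, Matrix.mulVec_mulVec, Matrix.mulVec_mulVec _ (NormedSpace.exp (t • A)),
    matrix_exp_smul_mul_exp_smul, add_neg_cancel, zero_smul, NormedSpace.exp_zero,
    Matrix.one_mulVec]

theorem continuous_mildSolution (hg : Continuous g) : Continuous (mildSolution A u₀ g) := by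
  have h : Continuous fun x => mildSolution A u₀ g x - g x :=
    continuous_iff_continuousAt.2 fun t => (hasDerivAt_mildSolution_sub hg t).continuousAt
  exact (h.add hg).congr fun x => by simp

theorem mildSolution_eq (hg : Continuous g) (t : ℝ) :
    mildSolution A u₀ g t = u₀ + (∫ r in (0 : ℝ)..t, A *ᵥ mildSolution A u₀ g r) + g t := by
  have hc : Continuous fun r => A *ᵥ mildSolution A u₀ g r :=
    continuous_const.matrix_mulVec (continuous_mildSolution hg)
  rw [intervalIntegral.integral_eq_sub_of_hasDerivAt
    (fun x _ => hasDerivAt_mildSolution_sub (u₀ := u₀) hg x) (hc.intervalIntegrable _ _)]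
  have h0 : mildSolution A u₀ g 0 - g 0 = u₀ := by simp [mildSolution]
  rw [h0]
  abel

/-- Set `v = u - g` on `[0, t]`. The integrating factor `e^{-xA}` removes `u` from the derivative,
leaving `e^{-xA} A g`, which integrates to the formula. -/
theorem eq_mildSolution (hg : Continuous g) {u : ℝ → V → ℝ} (hu : Continuous u)
    (h : ∀ t, 0 ≤ t → u t = u₀ + (∫ r in (0 : ℝ)..t, A *ᵥ u r) + g t) {t : ℝ} (ht : 0 ≤ t) :
    u t = mildSolution A u₀ g t := by
  set v : ℝ → V → ℝ := fun t => u₀ + ∫ r in (0 : ℝ)..t, A *ᵥ u r with hv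
  have hAu : Continuous fun r => A *ᵥ u r := continuous_const.matrix_mulVec hu
  have hv' : ∀ x, HasDerivAt v (A *ᵥ u x) x := fun x =>
    (hAu.integral_hasStrictDerivAt 0 x).hasDerivAt.const_add _
  have hE : ∀ x : ℝ, HasDerivAt (fun x : ℝ => NormedSpace.exp ((-x) • A))
      (-(A * NormedSpace.exp ((-x) • A))) x := fun x => by
    simpa using hasDerivAt_matrix_exp_sub_smul A 0 x
  have hz : ∀ x ∈ Set.uIcc 0 t, HasDerivAt (fun x => NormedSpace.exp ((-x) • A) *ᵥ v x)
      (NormedSpace.exp ((-x) • A) *ᵥ (A *ᵥ g x)) x := fun x hx => by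
    rw [Set.uIcc_of_le ht] at hx
    convert (hE x).matrix_mulVec (hv' x) using 1
    have : g x = u x - v x := by rw [h x hx.1]; simp [hv]
    rw [this, commute_matrix_exp_smul, Matrix.mulVec_sub, Matrix.mulVec_sub, Matrix.neg_mulVec,
      Matrix.mulVec_mulVec (v x)]
    abel
  have hI := intervalIntegral.integral_eq_sub_of_hasDerivAt hz
    ((continuous_exp_neg_mulVec hg).intervalIntegrable _ _)
  have hv0 : v 0 = u₀ := by simp [hv]
  rw [mildSolution, hI, hv0, neg_zero, zero_smul, NormedSpace.exp_zero, Matrix.one_mulVec,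
    add_sub_cancel, Matrix.mulVec_mulVec, matrix_exp_smul_mul_exp_smul, add_neg_cancel, zero_smul,
    NormedSpace.exp_zero, Matrix.one_mulVec, h t ht]

theorem hasDerivAt_exp_sub_mul_apply (A S : Matrix V V ℝ) (t r : ℝ) (i j : V) :
    HasDerivAt (fun r : ℝ => (NormedSpace.exp ((t - r) • A) * S) i j)
      (-(A * NormedSpace.exp ((t - r) • A) * S) i j) r := by
  have h := HasDerivAt.fun_sum (u := Finset.univ) fun k _ =>
    (hasDerivAt_pi.1 (hasDerivAt_pi.1 (hasDerivAt_matrix_exp_sub_smul A t r) i) k).mul_const (S k j)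
  simpa [Matrix.mul_apply (N := S)] using! h

theorem continuous_exp_sub_mul_apply (A B S : Matrix V V ℝ) (t : ℝ) (i j : V) :
    Continuous fun r : ℝ => (B * NormedSpace.exp ((t - r) • A) * S) i j :=
  ((continuous_const.matrix_mul ((continuous_matrix_exp_smul A).comp
    (continuous_const.sub continuous_id))).matrix_mul continuous_const).matrix_elem i j

/-- This is the integrated-by-parts Wiener integral of `F r = e^{(t-r)A} S`. The factor at `t - t`
stays unsimplified to match the boundary term `F t * w t`. -/
theorem mildSolution_apply (S : Matrix V V ℝ) {w : ℝ → V → ℝ} (hw : Continuous w) (t : ℝ) (i : V) :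
    mildSolution A u₀ (fun r => S *ᵥ w r) t i = (NormedSpace.exp (t • A) *ᵥ u₀) i +
      ∑ j, ((NormedSpace.exp ((t - t) • A) * S) i j * w t j -
        ∫ r in (0 : ℝ)..t, -(A * NormedSpace.exp ((t - r) • A) * S) i j * w r j) := by
  have hg : Continuous fun r => S *ᵥ w r := continuous_const.matrix_mulVec hw
  have hcomm := ContinuousLinearMap.intervalIntegral_comp_comm
    ((ContinuousLinearMap.proj (R := ℝ) (φ := fun _ : V => ℝ) i).comp
      (LinearMap.toContinuousLinearMap (NormedSpace.exp (t • A)).mulVecLin)) (μ := volume) ((continuous_exp_neg_mulVec (A := A) hg).intervalIntegrable 0 t)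
  simp only [ContinuousLinearMap.comp_apply, LinearMap.coe_toContinuousLinearMap',
    Matrix.mulVecLin_apply, ContinuousLinearMap.proj_apply] at hcomm
  have hterm : ∀ r, (NormedSpace.exp (t • A) *ᵥ
      (NormedSpace.exp ((-r) • A) *ᵥ (A *ᵥ (S *ᵥ w r)))) i =
      ∑ j, (A * NormedSpace.exp ((t - r) • A) * S) i j * w r j := fun r => by
    rw [Matrix.mulVec_mulVec, Matrix.mulVec_mulVec, Matrix.mulVec_mulVec,
      matrix_exp_smul_mul_exp_smul, ← sub_eq_add_neg, ← commute_matrix_exp_smul]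
    rfl
  simp_rw [hterm] at hcomm
  have hc : ∀ j, Continuous fun r => (A * NormedSpace.exp ((t - r) • A) * S) i j * w r j :=
    fun j => (continuous_exp_sub_mul_apply A A S t i j).mul ((continuous_apply j).comp hw)
  rw [intervalIntegral.integral_finsetSum fun j _ => (hc j).intervalIntegrable _ _] at hcomm
  simp only [mildSolution, Matrix.mulVec_add, Pi.add_apply, sub_self, zero_smul,
    NormedSpace.exp_zero, Matrix.one_mul, neg_mul, intervalIntegral.integral_neg, sub_neg_eq_add,
    Finset.sum_add_distrib]
  rw [← hcomm, add_assoc, add_comm (∑ j, S i j * w t j)]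
  rfl

end LinearODE

/-! ### Wiener integrals of smooth deterministic kernels. -/

section Wiener

open Filter Topology Finset

variable {Ω : Type*} [MeasurableSpace Ω] {μ : Measure Ω}

theorem isGaussianProcess_const_add {T : Type*} {X : T → Ω → ℝ} (hX : IsGaussianProcess X μ)
    (m : T → ℝ) : IsGaussianProcess (fun t ω => m t + X t ω) μ := by
  refine ⟨fun I => ⟨?_⟩⟩
  have h := (hX.hasGaussianLaw I).isGaussian_map
  have h2 : μ.map (fun ω => I.restrict fun t => m t + X t ω) =
      (μ.map fun ω => I.restrict (X · ω)).map fun x => I.restrict m + x := by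
    rw [AEMeasurable.map_map_of_aemeasurable (by fun_prop) (hX.hasGaussianLaw I).aemeasurable]
    rfl
  rw [h2]
  infer_instance

variable {V : Type*} {W : ℝ≥0 → Ω → V → ℝ}

theorem IsBrownianVector.isGaussianProcess [Fintype V] [IsProbabilityMeasure μ]
    (hW : IsBrownianVector W μ) :
    IsGaussianProcess (fun (p : ℝ≥0 × V) ω => W p.1 ω p.2) μ := by
  classical
  refine ⟨fun I => ?_⟩
  -- Independence makes the coordinates jointly Gaussian on the full grid `V × J`, from which `I` is
  -- extracted linearly.
  set J := I.image Prod.fst with hJ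
  have h1 : HasGaussianLaw (fun ω (i : V) (t : J) => W t ω i) μ := by
    refine iIndepFun.hasGaussianLaw (X := fun (i : V) ω (t : J) => W t ω i)
      (fun i => (IsPreBrownianReal.isGaussianProcess
        (hW.brownian i).toIsPreBrownianReal).hasGaussianLaw J) ?_
    exact hW.indep.comp (fun _ (f : ℝ≥0 → ℝ) (t : J) => f t) fun _ => by fun_prop
  let L : (V → J → ℝ) →L[ℝ] (I → ℝ) :=
    { toFun := fun x p => x p.1.2 ⟨p.1.1, mem_image_of_mem _ p.2⟩
      map_add' := fun _ _ => rfl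
      map_smul' := fun _ _ => rfl
      cont := by fun_prop }
  exact h1.map_fun L

theorem IsBrownianVector.memLp_two (hW : IsBrownianVector W μ) (t : ℝ≥0) (i : V) :
    MemLp (fun ω => W t ω i) 2 μ :=
  have h := IsPreBrownianReal.isGaussianProcess (hW.brownian i).toIsPreBrownianReal
  (h.hasGaussianLaw_eval t).memLp_two

theorem IsBrownianVector.covariance [DecidableEq V] [IsProbabilityMeasure μ]
    (hW : IsBrownianVector W μ) (s t : ℝ≥0) (i j : V) :
    cov[fun ω => W s ω i, fun ω => W t ω j; μ] = if i = j then min (s : ℝ) t else 0 := by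
  split_ifs with h
  · subst h
    simpa using (hW.brownian i).covariance_fun_eval s t
  · refine IndepFun.covariance_eq_zero ?_ (hW.memLp_two s i) (hW.memLp_two t j)
    exact (hW.indep.indepFun h).comp (measurable_pi_apply s) (measurable_pi_apply t)

/-- The increment over `[r, r']`, stopped at time `t`, of the `j`-th coordinate of `W`. -/
def stoppedIncrement (W : ℝ≥0 → Ω → V → ℝ) (r r' : ℝ) (t : ℝ≥0) (j : V) (ω : Ω) : ℝ :=
  W (min r' t).toNNReal ω j - W (min r t).toNNReal ω j

/-- Since Brownian covariances are minima, this says that stopped increments over nonoverlapping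
intervals are uncorrelated. -/
theorem min_add_min_sub_min_sub_min {r r' q q' t s : ℝ} (hr : r ≤ r') (hq : q ≤ q')
    (h : r' ≤ q) :
    min (min r' t) (min q' s) - min (min r' t) (min q s) -
      (min (min r t) (min q' s) - min (min r t) (min q s)) = 0 := by
  simp only [min_min_min_comm _ t]
  rw [min_eq_left h, min_eq_left (h.trans hq), min_eq_left (hr.trans h),
    min_eq_left (hr.trans (h.trans hq))]
  ring

/-- On a common interval, the covariance is the length of its part before `min t s`. -/
theorem min_add_min_sub_min_sub_min_self {r r' t s : ℝ} (hr : r ≤ r') :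
    min (min r' t) (min r' s) - min (min r' t) (min r s) -
      (min (min r t) (min r' s) - min (min r t) (min r s)) =
      min r' (min t s) - min r (min t s) := by
  simp only [min_min_min_comm _ t]
  rw [min_eq_left hr, min_eq_right hr, min_self, min_self]
  ring

theorem memLp_stoppedIncrement [IsProbabilityMeasure μ] (hW : IsBrownianVector W μ)
    (r r' : ℝ) (t : ℝ≥0) (j : V) : MemLp (stoppedIncrement W r r' t j) 2 μ :=
  (hW.memLp_two _ j).sub (hW.memLp_two _ j)

theorem integral_stoppedIncrement (hW : IsBrownianVector W μ)
    (r r' : ℝ) (t : ℝ≥0) (j : V) : ∫ ω, stoppedIncrement W r r' t j ω ∂μ = 0 := by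
  unfold stoppedIncrement
  rw [integral_sub ((hW.brownian j).integrable_eval _) ((hW.brownian j).integrable_eval _),
    (hW.brownian j).integral_eval, (hW.brownian j).integral_eval, sub_zero]

theorem covariance_stoppedIncrement [DecidableEq V] [IsProbabilityMeasure μ]
    (hW : IsBrownianVector W μ) {r r' q q' : ℝ} (hr : 0 ≤ r) (hr' : 0 ≤ r') (hq : 0 ≤ q)
    (hq' : 0 ≤ q') (t s : ℝ≥0) (i j : V) :
    cov[stoppedIncrement W r r' t i, stoppedIncrement W q q' s j; μ] = if i = j then
      min (min r' t) (min q' s) - min (min r' t) (min q s) -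
        (min (min r t) (min q' s) - min (min r t) (min q s)) else 0 := by
  unfold stoppedIncrement
  rw [covariance_fun_sub_fun_sub (hW.memLp_two _ _) (hW.memLp_two _ _) (hW.memLp_two _ _)
    (hW.memLp_two _ _)]
  simp only [hW.covariance]
  rw [Real.coe_toNNReal _ (le_min hr t.coe_nonneg), Real.coe_toNNReal _ (le_min hr' t.coe_nonneg),
    Real.coe_toNNReal _ (le_min hq s.coe_nonneg), Real.coe_toNNReal _ (le_min hq' s.coe_nonneg)]
  split_ifs
  · ring
  · simp

theorem covariance_stoppedIncrement_grid [DecidableEq V] [IsProbabilityMeasure μ]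
    (hW : IsBrownianVector W μ) (n : ℕ) (t s : ℝ≥0) (x y : V × ℕ) :
    cov[stoppedIncrement W (x.2 / (n + 1)) ((x.2 + 1 : ℕ) / (n + 1)) t x.1,
      stoppedIncrement W (y.2 / (n + 1)) ((y.2 + 1 : ℕ) / (n + 1)) s y.1; μ] = if x = y then
      min ((x.2 + 1 : ℕ) / (n + 1) : ℝ) (min (t : ℝ) s) -
        min (x.2 / (n + 1) : ℝ) (min (t : ℝ) s) else 0 := by
  have hn : (0 : ℝ) < n + 1 := by positivity
  have hstep : ∀ {k l : ℕ}, k ≤ l → (k : ℝ) / (n + 1) ≤ (l : ℝ) / (n + 1) := fun h => by gcongr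
  rw [covariance_stoppedIncrement hW (by positivity) (by positivity) (by positivity)
    (by positivity)]
  obtain ⟨i, k⟩ := x
  obtain ⟨j, l⟩ := y
  simp only [Prod.mk.injEq]
  by_cases hij : i = j
  · rw [if_pos hij]
    rcases lt_trichotomy k l with h | h | h
    · rw [if_neg (by omega),
        min_add_min_sub_min_sub_min (hstep k.le_succ) (hstep l.le_succ) (hstep h)]
    · subst h
      rw [if_pos ⟨hij, rfl⟩, min_add_min_sub_min_sub_min_self (hstep k.le_succ)]
    · rw [if_neg (by omega),
        ← min_add_min_sub_min_sub_min (t := s) (s := t) (hstep l.le_succ) (hstep k.le_succ)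
          (hstep h)]
      simp only [min_comm (min _ (t : ℝ))]
      ring
  · rw [if_neg hij, if_neg fun h => hij h.1]

variable [Fintype V] {T : Type*}

/-- Riemann sums with mesh `1 / (n + 1)` for the Wiener integrals `∑ j, ∫₀^(τ p) F p j dW_j`. -/
noncomputable def wienerSum (W : ℝ≥0 → Ω → V → ℝ) (F : T → V → ℝ → ℝ) (τ : T → ℝ≥0) (n : ℕ)
    (p : T) (ω : Ω) : ℝ :=
  ∑ x ∈ (univ : Finset V) ×ˢ range ((n + 1) ^ 2), F p x.1 (x.2 / (n + 1)) *
    stoppedIncrement W (x.2 / (n + 1)) ((x.2 + 1 : ℕ) / (n + 1)) (τ p) x.1 ω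

theorem isGaussianProcess_wienerSum [IsProbabilityMeasure μ] (hW : IsBrownianVector W μ)
    (F : T → V → ℝ → ℝ) (τ : T → ℝ≥0) (n : ℕ) : IsGaussianProcess (wienerSum W F τ n) μ := by
  classical
  refine hW.isGaussianProcess.of_isGaussianProcess fun p => ?_
  set N := (univ : Finset V) ×ˢ range ((n + 1) ^ 2) with hN
  set a : V × ℕ → ℝ≥0 × V := fun x => ((min (x.2 / (n + 1) : ℝ) (τ p)).toNNReal, x.1) with ha
  set b : V × ℕ → ℝ≥0 × V :=
    fun x => ((min ((x.2 + 1 : ℕ) / (n + 1) : ℝ) (τ p)).toNNReal, x.1) with hb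
  refine ⟨N.image a ∪ N.image b, ∑ x ∈ N.attach, F p x.1.1 (x.1.2 / (n + 1)) •
    (ContinuousLinearMap.proj (R := ℝ) (φ := fun _ => ℝ)
      ⟨b x.1, mem_union_right _ (mem_image_of_mem _ x.2)⟩ -
    ContinuousLinearMap.proj (R := ℝ) (φ := fun _ => ℝ)
      ⟨a x.1, mem_union_left _ (mem_image_of_mem _ x.2)⟩), fun ω => ?_⟩
  rw [wienerSum, ← sum_attach]
  simp [stoppedIncrement, ha, hb]
  rfl

theorem integral_wienerSum [IsProbabilityMeasure μ] (hW : IsBrownianVector W μ)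
    (F : T → V → ℝ → ℝ) (τ : T → ℝ≥0) (n : ℕ) (p : T) : ∫ ω, wienerSum W F τ n p ω ∂μ = 0 := by
  unfold wienerSum
  rw [integral_finsetSum _ fun x _ =>
    ((memLp_stoppedIncrement hW _ _ _ _).integrable (by norm_num)).const_mul _]
  simp [integral_const_mul, integral_stoppedIncrement hW]

theorem covariance_wienerSum [IsProbabilityMeasure μ] (hW : IsBrownianVector W μ)
    (F : T → V → ℝ → ℝ) (τ : T → ℝ≥0) (n : ℕ) (p q : T) :
    cov[wienerSum W F τ n p, wienerSum W F τ n q; μ] = ∑ j, ∑ k ∈ range ((n + 1) ^ 2),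
      F p j (k / (n + 1)) * F q j (k / (n + 1)) *
        (min ((k + 1 : ℕ) / (n + 1) : ℝ) (min (τ p : ℝ) (τ q)) -
          min (k / (n + 1) : ℝ) (min (τ p : ℝ) (τ q))) := by
  classical
  unfold wienerSum
  rw [covariance_fun_sum_fun_sum' (fun x _ => (memLp_stoppedIncrement hW _ _ _ _).const_mul _)
    (fun x _ => (memLp_stoppedIncrement hW _ _ _ _).const_mul _)]
  refine Eq.trans (sum_congr rfl fun x hx => ?_) (sum_product' univ (range ((n + 1) ^ 2)) _)
  simp_rw [covariance_const_mul_left, covariance_const_mul_right,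
    covariance_stoppedIncrement_grid hW, mul_ite, mul_zero, sum_ite_eq, if_pos hx, mul_assoc]

/-- A process given pathwise by `∑ j, ∫₀^(τ p) F p j dW_j`, where the Wiener integrals are written
by partial integration, is Gaussian, and its covariances are given by the Itô isometry. -/
theorem isGaussianProcess_wienerIntegral [IsProbabilityMeasure μ] (hW : IsBrownianVector W μ)
    {F F' : T → V → ℝ → ℝ} {τ : T → ℝ≥0}
    (hF : ∀ p j x, HasDerivAt (F p j) (F' p j x) x) (hF' : ∀ p j, Continuous (F' p j))
    {Y : T → Ω → ℝ} (hY : ∀ p, ∀ᵐ ω ∂μ, Y p ω = ∑ j, (F p j (τ p) * W (τ p) ω j -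
      ∫ r in (0 : ℝ)..τ p, F' p j r * W r.toNNReal ω j)) :
    IsGaussianProcess Y μ ∧ ∀ p q, cov[Y p, Y q; μ] =
      ∑ j, ∫ r in (0 : ℝ)..(min (τ p) (τ q) : ℝ), F p j r * F q j r := by
  have hFc : ∀ p j, Continuous (F p j) := fun p j =>
    continuous_iff_continuousAt.2 fun x => (hF p j x).continuousAt
  refine isGaussianProcess_of_tendsto_ae (X := fun n => wienerSum W F τ n) (m := 0)
    (isGaussianProcess_wienerSum hW F τ) (fun p => ?_) (fun p q => ?_) (fun p => ?_)
  · simp [integral_wienerSum hW]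
  · simp_rw [covariance_wienerSum hW]
    refine tendsto_finsetSum _ fun j _ => ?_
    exact tendsto_riemann_sum (F := fun r => F p j r * F q j r)
      (fun x => (hF p j x).mul (hF q j x))
      (((hF' p j).mul (hFc q j)).add ((hFc p j).mul (hF' q j))) (le_min (τ p).2 (τ q).2)
  · filter_upwards [hY p, ae_all_iff.2 fun j => (hW.brownian j).cont,
      ae_all_iff.2 fun j => (hW.brownian j).eval_zero_ae_eq_zero] with ω h1 h2 h3
    rw [h1]
    simp_rw [wienerSum, sum_product]
    refine tendsto_finsetSum _ fun j _ => ?_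
    -- The boundary term at `0` drops out because `W` starts at `0`.
    have h := tendsto_riemannStieltjes (w := fun r => W r.toNNReal ω j) (hF p j) (hF' p j)
      ((h2 j).comp continuous_real_toNNReal) (τ p).2
    simpa [h3 j, stoppedIncrement] using h

end Wiener

/-! ### The linear stochastic equation. -/

section LinearSDE

variable {V Ω : Type*} [Fintype V] [MeasurableSpace Ω] {μ : Measure Ω}
  {A S : Matrix V V ℝ} {u₀ : V → ℝ} {W u : ℝ≥0 → Ω → V → ℝ}

theorem IsBrownianVector.ae_continuous (hW : IsBrownianVector W μ) :
    ∀ᵐ ω ∂μ, Continuous fun r : ℝ => W r.toNNReal ω := by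
  filter_upwards [ae_all_iff.2 fun j => (hW.brownian j).cont] with ω h
  exact continuous_pi fun j => (h j).comp continuous_real_toNNReal

variable [DecidableEq V]

theorem IsBrownianVector.isLinearSDESolution_mildSolution (hW : IsBrownianVector W μ) :
    IsLinearSDESolution A S u₀ W
      (fun t ω => mildSolution A u₀ (fun r => S *ᵥ W r.toNNReal ω) t) μ := by
  filter_upwards [hW.ae_continuous] with ω h
  have hg : Continuous fun r : ℝ => S *ᵥ W r.toNNReal ω := continuous_const.matrix_mulVec h
  refine ⟨(continuous_mildSolution hg).comp NNReal.continuous_coe, fun t => ?_⟩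
  rw [mildSolution_eq hg, Real.toNNReal_coe]
  congr 2
  refine intervalIntegral.integral_congr fun r hr => ?_
  rw [Set.uIcc_of_le t.coe_nonneg] at hr
  simp only [Real.coe_toNNReal r hr.1]

/-- Pathwise uniqueness gives one exceptional null set for all times, hence indistinguishability. -/
theorem IsLinearSDESolution.ae_eq_mildSolution (hu : IsLinearSDESolution A S u₀ W u μ)
    (hW : IsBrownianVector W μ) :
    ∀ᵐ ω ∂μ, ∀ t, u t ω = mildSolution A u₀ (fun r => S *ᵥ W r.toNNReal ω) t := by
  filter_upwards [hu, hW.ae_continuous] with ω h hc t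
  have hg : Continuous fun r : ℝ => S *ᵥ W r.toNNReal ω := continuous_const.matrix_mulVec hc
  have h1 := eq_mildSolution (A := A) (u₀ := u₀) hg (u := fun r => u r.toNNReal ω)
    (h.1.comp continuous_real_toNNReal) (fun r hr => ?_) t.coe_nonneg
  · simpa using h1
  · have h2 := h.2 r.toNNReal
    rwa [Real.coe_toNNReal r hr] at h2

/-- Indexing by pairs (time, vertex) and removing the mean `e^{tA} u₀` leaves a family of scalar
Wiener integrals. -/
theorem IsLinearSDESolution.isGaussianProcess_covariance [IsProbabilityMeasure μ]
    (hu : IsLinearSDESolution A S u₀ W u μ) (hW : IsBrownianVector W μ) :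
    IsGaussianProcess (fun (p : ℝ≥0 × V) ω => u p.1 ω p.2) μ ∧ ∀ (t s : ℝ≥0) (i j : V),
      cov[fun ω => u t ω i, fun ω => u s ω j; μ] = ∫ r in (0 : ℝ)..(min t s : ℝ),
        (NormedSpace.exp (((t : ℝ) - r) • A) * S *
          (NormedSpace.exp (((s : ℝ) - r) • A) * S)ᵀ) i j := by
  set m : ℝ≥0 × V → ℝ := fun p => (NormedSpace.exp ((p.1 : ℝ) • A) *ᵥ u₀) p.2 with hm
  have hFc : ∀ (t : ℝ≥0) (i j : V),
      Continuous fun r : ℝ => (NormedSpace.exp (((t : ℝ) - r) • A) * S) i j := fun t i j => by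
    simpa using continuous_exp_sub_mul_apply A 1 S t i j
  obtain ⟨hG, hC⟩ := isGaussianProcess_wienerIntegral hW (T := ℝ≥0 × V)
    (F := fun p j r => (NormedSpace.exp (((p.1 : ℝ) - r) • A) * S) p.2 j)
    (F' := fun p j r => -(A * NormedSpace.exp (((p.1 : ℝ) - r) • A) * S) p.2 j)
    (τ := fun p => p.1) (Y := fun p ω => u p.1 ω p.2 - m p)
    (fun p j x => hasDerivAt_exp_sub_mul_apply A S p.1 x p.2 j)
    (fun p j => (continuous_exp_sub_mul_apply A A S p.1 p.2 j).neg)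
    (fun p => by
      filter_upwards [hu.ae_eq_mildSolution hW, hW.ae_continuous] with ω h hc
      rw [h, mildSolution_apply S hc]
      simp [hm])
  have hG' := isGaussianProcess_const_add hG m
  simp only [add_sub_cancel] at hG'
  refine ⟨hG', fun t s i j => ?_⟩
  have hint : ∀ p : ℝ≥0 × V, Integrable (fun ω => u p.1 ω p.2) μ := fun p =>
    (hG'.hasGaussianLaw_eval p).integrable
  have h := hC (t, i) (s, j)
  rw [covariance_sub_const_left (hint (t, i)), covariance_sub_const_right (hint (s, j))] at h
  have hc : ∀ k, Continuous fun r : ℝ => (NormedSpace.exp (((t : ℝ) - r) • A) * S) i k *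
      (NormedSpace.exp (((s : ℝ) - r) • A) * S) j k := fun k => (hFc t i k).mul (hFc s j k)
  exact h.trans (intervalIntegral.integral_finsetSum fun k _ =>
    (hc k).intervalIntegrable _ _).symm

theorem IsLinearSDESolution.isGaussianProcess [IsProbabilityMeasure μ]
    (hu : IsLinearSDESolution A S u₀ W u μ) (hW : IsBrownianVector W μ) :
    IsGaussianProcess u μ := by
  classical
  obtain ⟨hscalar, -⟩ := hu.isGaussianProcess_covariance hW
  refine hscalar.of_isGaussianProcess fun t =>
    ⟨Finset.univ.image (Prod.mk t), ContinuousLinearMap.pi fun i => ContinuousLinearMap.proj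
      ⟨(t, i), Finset.mem_image_of_mem _ (Finset.mem_univ i)⟩, fun ω => ?_⟩
  ext i
  simp

end LinearSDE

/-! ### Evaluation of the covariance integral. -/

section ClosedForm

variable {V : Type*} [Fintype V]

theorem mul_map_integral_mul_apply (P R : Matrix V V ℂ) {K : ℝ → Matrix V V ℝ}
    (hK : ∀ i j, Continuous fun r => K r i j) (a b : ℝ) (i j : V) :
    (P * (Matrix.of fun i j => ∫ r in a..b, K r i j).map Complex.ofReal * R) i j =
      ∫ r in a..b, (P * (K r).map Complex.ofReal * R) i j := by
  have hc : ∀ k l, Continuous fun r => P i l * (K r l k : ℂ) := fun k l =>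
    continuous_const.mul (Complex.continuous_ofReal.comp (hK l k))
  have hc2 : ∀ k, Continuous fun r => (∑ l, P i l * (K r l k : ℂ)) * R k j := fun k =>
    (continuous_finsetSum _ fun l _ => hc k l).mul continuous_const
  simp only [Matrix.mul_apply, Matrix.map_apply, Matrix.of_apply]
  rw [intervalIntegral.integral_finsetSum fun k _ => (hc2 k).intervalIntegrable _ _]
  refine Finset.sum_congr rfl fun k _ => ?_
  rw [intervalIntegral.integral_mul_const,
    intervalIntegral.integral_finsetSum fun l _ => (hc k l).intervalIntegrable _ _]
  congr 1
  refine Finset.sum_congr rfl fun l _ => ?_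
  rw [intervalIntegral.integral_const_mul, intervalIntegral.integral_ofReal]

theorem integral_exp_sub_mul_exp_sub {c a b : ℝ} (hc : c ≠ 0) (hab : a + b ≠ 0) (t s : ℝ) :
    ∫ r in (0 : ℝ)..s, Real.exp (-c * a * (t - r)) * Real.exp (-c * b * (s - r)) =
      (Real.exp (-c * a * (t - s)) - Real.exp (-c * (a * t + b * s))) / (c * (a + b)) := by
  have hd : ∀ r : ℝ, HasDerivAt
      (fun r => Real.exp (-c * a * (t - r) + -c * b * (s - r)) / (c * (a + b)))
      (Real.exp (-c * a * (t - r)) * Real.exp (-c * b * (s - r))) r := fun r => by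
    have h1 : HasDerivAt (fun r => -c * a * (t - r) + -c * b * (s - r)) (c * (a + b)) r :=
      ((((hasDerivAt_id r).const_sub t).const_mul (-c * a)).add
        (((hasDerivAt_id r).const_sub s).const_mul (-c * b))).congr_deriv (by ring)
    refine (h1.exp.div_const (c * (a + b))).congr_deriv ?_
    rw [mul_div_assoc, div_self (mul_ne_zero hc hab), mul_one, Real.exp_add]
  rw [intervalIntegral.integral_eq_sub_of_hasDerivAt (fun r _ => hd r)
    (Continuous.intervalIntegrable (by fun_prop) _ _), ← sub_div]
  congr 3 <;> ring

variable [DecidableEq V]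

/-- Inserting `Pᴴ * P = 1` around `S * Sᵀ` isolates `P Σ Σᵀ P*` between two diagonal exponentials,
so only a scalar integral depends on `r`. -/
theorem unitary_conj_covariance {M S : Matrix V V ℝ} {c : ℝ} (hc : c ≠ 0) {P : Matrix V V ℂ}
    (hP : P ∈ Matrix.unitaryGroup V ℂ) {l : V → ℝ} (hl : ∀ i, 0 < l i)
    (h : P * M.map Complex.ofReal * Pᴴ = Matrix.diagonal (fun i => (l i : ℂ))) {t s : ℝ}
    (hst : s ≤ t) :
    P * (Matrix.of fun i j => ∫ r in (0 : ℝ)..s, (NormedSpace.exp ((t - r) • (-c • M)) * S *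
      (NormedSpace.exp ((s - r) • (-c • M)) * S)ᵀ) i j).map Complex.ofReal * Pᴴ =
      shekCore c S P l t s := by
  have hPP : Pᴴ * P = 1 := Matrix.mem_unitaryGroup_iff'.1 hP
  have hA : P * (-c • M).map Complex.ofReal * Pᴴ =
      Matrix.diagonal fun i => ((-c * l i : ℝ) : ℂ) := by
    have h1 : (-c • M).map Complex.ofReal = ((-c : ℝ) : ℂ) • M.map Complex.ofReal := by
      ext i j; simp
    rw [h1, Matrix.mul_smul, Matrix.smul_mul, h, ← Matrix.diagonal_smul]
    congr 1
    ext i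
    simp
  have hE : ∀ x : ℝ, P * (NormedSpace.exp (x • (-c • M))).map Complex.ofReal * Pᴴ =
      Matrix.diagonal fun i => ((Real.exp (-c * l i * x) : ℝ) : ℂ) := fun x => by
    rw [unitary_conj_map_exp hP hA]
    congr 1
    ext i
    push_cast
    ring_nf
  have hmap : ∀ X Y : Matrix V V ℝ, (X * Y).map Complex.ofReal =
      X.map Complex.ofReal * Y.map Complex.ofReal := fun X Y =>
    Matrix.map_mul (f := Complex.ofRealHom)
  have htr : ∀ X : Matrix V V ℝ, Xᵀ.map Complex.ofReal = (X.map Complex.ofReal)ᴴ := fun X => by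
    ext i j; simp
  have hconj : ∀ r : ℝ, P * (NormedSpace.exp ((t - r) • (-c • M)) * S *
      (NormedSpace.exp ((s - r) • (-c • M)) * S)ᵀ).map Complex.ofReal * Pᴴ =
      (Matrix.diagonal fun i => ((Real.exp (-c * l i * (t - r)) : ℝ) : ℂ)) *
        (P * (S * Sᵀ).map Complex.ofReal * Pᴴ) *
        (Matrix.diagonal fun i => ((Real.exp (-c * l i * (s - r)) : ℝ) : ℂ)) := fun r => by
    -- The transposed factor is the adjoint of the first kind; its diagonal is unchanged because the
    -- `l i` are real.
    have h2 : (Matrix.diagonal fun i => ((Real.exp (-c * l i * (s - r)) : ℝ) : ℂ)) =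
        P * ((NormedSpace.exp ((s - r) • (-c • M))).map Complex.ofReal)ᴴ * Pᴴ := by
      have h3 := congrArg Matrix.conjTranspose (hE (s - r))
      rw [Matrix.diagonal_conjTranspose, Matrix.conjTranspose_mul, Matrix.conjTranspose_mul,
        Matrix.conjTranspose_conjTranspose, ← mul_assoc] at h3
      rw [h3]
      congr 1
      ext i
      simp only [Pi.star_apply, RCLike.star_def, Complex.conj_ofReal]
    rw [h2, ← hE (t - r)]
    simp only [Matrix.transpose_mul, hmap, htr]
    simp only [mul_assoc]
    simp only [← mul_assoc Pᴴ P, hPP, one_mul]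
  ext i j
  have hcont : ∀ (x : ℝ) (i j : V), Continuous fun r : ℝ =>
      (NormedSpace.exp ((x - r) • (-c • M)) * S) i j := fun x i j => by
    simpa using continuous_exp_sub_mul_apply (-c • M) 1 S x i j
  have hK : ∀ i j : V, Continuous fun r : ℝ => (NormedSpace.exp ((t - r) • (-c • M)) * S *
      (NormedSpace.exp ((s - r) • (-c • M)) * S)ᵀ) i j := fun i j =>
    continuous_finsetSum _ fun k _ => (hcont t i k).mul (hcont s j k)
  rw [mul_map_integral_mul_apply _ _ hK]
  simp_rw [hconj, Matrix.mul_diagonal, Matrix.diagonal_mul]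
  have hint : ∀ r : ℝ, ((Real.exp (-c * l i * (t - r)) : ℝ) : ℂ) *
      (P * (S * Sᵀ).map Complex.ofReal * Pᴴ) i j * ((Real.exp (-c * l j * (s - r)) : ℝ) : ℂ) =
      ((Real.exp (-c * l i * (t - r)) * Real.exp (-c * l j * (s - r)) : ℝ) : ℂ) *
        (P * (S * Sᵀ).map Complex.ofReal * Pᴴ) i j := fun r => by
    rw [Complex.ofReal_mul]; ring
  have hlij : l i + l j ≠ 0 := (add_pos (hl i) (hl j)).ne'
  simp_rw [hint]
  rw [intervalIntegral.integral_mul_const, intervalIntegral.integral_ofReal,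
    integral_exp_sub_mul_exp_sub hc hlij, shekCore, Matrix.of_apply,
    abs_of_nonneg (sub_nonneg.2 hst), Complex.ofReal_div, Complex.ofReal_mul]
  rw [one_div, div_eq_mul_inv, div_eq_mul_inv, mul_inv]
  ring

end ClosedForm

/-! ### The main theorem. -/

theorem mainTheorem3 {V Ω : Type*} [Fintype V] [DecidableEq V] [MeasurableSpace Ω]
    (μ : Measure Ω) [IsProbabilityMeasure μ]
    (G : WeightedGraph V) (L : Matrix V V ℝ)
    (hL : L = G.laplacian ∨ L = G.normalizedLaplacian)
    (ν κ c : ℝ) (hν : 0 < ν) (hκ : 0 < κ) (hc : c ≠ 0)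
    (S : Matrix V V ℝ) (u₀ : V → ℝ)
    (W : ℝ≥0 → Ω → V → ℝ) (hW : IsBrownianVector W μ) :
    -- the fractional Laplacian is positive definite and unitarily diagonalizable
    (fractionalLaplacian L ν κ).PosDef ∧
    (∃ P ∈ Matrix.unitaryGroup V ℂ, ∃ l : V → ℝ,
      P * (fractionalLaplacian L ν κ).map Complex.ofReal * Pᴴ =
        Matrix.diagonal (fun i => (l i : ℂ))) ∧
    -- the equation has a solution, unique up to indistinguishability
    (∃ u : ℝ≥0 → Ω → V → ℝ,
      IsLinearSDESolution (-c • fractionalLaplacian L ν κ) S u₀ W u μ ∧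
      ∀ v : ℝ≥0 → Ω → V → ℝ,
        IsLinearSDESolution (-c • fractionalLaplacian L ν κ) S u₀ W v μ →
        ∀ᵐ ω ∂μ, ∀ t, v t ω = u t ω) ∧
    -- the solution is a Gaussian process with the stated covariance
    (∀ u : ℝ≥0 → Ω → V → ℝ,
      IsLinearSDESolution (-c • fractionalLaplacian L ν κ) S u₀ W u μ →
      IsGaussianProcess u μ ∧
      ∀ P ∈ Matrix.unitaryGroup V ℂ, ∀ l : V → ℝ,
        P * (fractionalLaplacian L ν κ).map Complex.ofReal * Pᴴ =
          Matrix.diagonal (fun i => (l i : ℂ)) →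
        ∀ s t : ℝ≥0, s ≤ t →
          (crossCovariance (u t) (u s) μ).map Complex.ofReal =
            Pᴴ * shekCore c S P l t s * P) := by
  have hpsd : L.PosSemidef := by
    rcases hL with rfl | rfl
    · exact G.posSemidef_laplacian
    · exact G.posSemidef_normalizedLaplacian
  have hpd : (fractionalLaplacian L ν κ).PosDef := posDef_fractionalLaplacian hpsd hν hκ
  refine ⟨hpd, exists_unitary_diagonalization hpd.isHermitian.map_ofReal,
    ⟨_, hW.isLinearSDESolution_mildSolution, fun v hv => hv.ae_eq_mildSolution hW⟩,
    fun u hu => ⟨hu.isGaussianProcess hW, fun P hP l hl s t hst => ?_⟩⟩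
  have hst' : (s : ℝ) ≤ t := NNReal.coe_le_coe.2 hst
  have hPP : Pᴴ * P = 1 := Matrix.mem_unitaryGroup_iff'.1 hP
  have hcov : crossCovariance (u t) (u s) μ = Matrix.of fun i j => ∫ r in (0 : ℝ)..s,
      (NormedSpace.exp (((t : ℝ) - r) • (-c • fractionalLaplacian L ν κ)) * S *
        (NormedSpace.exp (((s : ℝ) - r) • (-c • fractionalLaplacian L ν κ)) * S)ᵀ) i j := by
    ext i j
    have h := (hu.isGaussianProcess_covariance hW).2 t s i j
    rw [min_eq_right hst'] at h
    exact h
  rw [← unitary_conj_covariance hc hP (pos_of_unitary_diagonalization hpd.map_ofReal hP hl) hl hst',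
    ← hcov]
  simp only [mul_assoc, hPP, mul_one]
  rw [← mul_assoc, hPP, one_mul]
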